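/- Let $m\ge 1$ and $0\le n<N$ be integers, let $\zeta_j=e^{ij\pi/N}$, let $\mathbb{T}_{2N}=\{\zeta_j : j=-N+1,\dots,N\}$ be the discrete unit circle, and let $\nu$ be the discrete measure in $\theta\in(-\pi,\pi]$ with mass $\frac1{2N}$ at each angle $\frac{j\pi}{N}$, $j=-N+1,\dots,N$. Let $\mathfrak{P}_+^{(m,n)}(N)$ be the cone of all Hermitian $m\times m$ matrix pseudo-polynomials $Q(\zeta)=\sum_{k=-n}^n Q_k\zeta^{-k}$, $Q_k\in\mathbb{C}^{m\times m}$, $Q_{-k}=Q_k^*$, of degree at most $n$, that are positive definite at every point of $\mathbb{T}_{2N}$; pseudo-polynomials are identified with their coefficients, and for $m=1$ they are regarded as scalar. Let $\mathfrak{C}_+^{(m,n)}(N)$ be the set of all $C=(C_0,C_1,\dots,C_n)$, $C_k\in\mathbb{C}^{m\times m}$, with $C_0=C_0^*$, such that, setting $C_{-k}=C_k^*$, $$\langle C,Q\rangle:=\sum_{k=-n}^n\operatorname{tr}(C_kQ_k^*)>0\quad\text{for all } Q\in\overline{\mathfrak{P}_+^{(m,n)}(N)}\setminus\{0\}.$$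 Then, for every $C\in\mathfrak{C}_+^{(m,n)}(N)$ and every $P\in\mathfrak{P}_+^{(1,n)}(N)$, there is a unique $Q\in\mathfrak{P}_+^{(m,n)}(N)$ such that $\Phi=PQ^{-1}$ satisfies the moment conditions $$\int_{-\pi}^{\pi}e^{ik\theta}\,\Phi(e^{i\theta})\,d\nu(\theta)=C_k,\qquad k=0,1,\dots,n.$$ -/

import Mathlib

open scoped ComplexOrder Matrix

noncomputable section

namespace CirculantExt

/-- A tuple `(A_0, …, A_n)` of complex `m × m` matrices. It stores the coefficients with
nonnegative index of a Hermitian sequence `A_k`, `-n ≤ k ≤ n`, `A_{-k} = A_k^*`. -/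
abbrev Coeffs (m n : ℕ) : Type := Fin (n + 1) → Matrix (Fin m) (Fin m) ℂ

/-- The coefficient `A_k`, `k ∈ ℤ`, of the Hermitian extension of `(A_0, …, A_n)`:
`A_{-k} = A_k^*` for `1 ≤ k ≤ n`, and `A_k = 0` for `|k| > n`. -/
def coeff {m n : ℕ} (A : Coeffs m n) (k : ℤ) : Matrix (Fin m) (Fin m) ℂ :=
  if h : k.natAbs < n + 1 then
    if 0 ≤ k then A ⟨k.natAbs, h⟩ else (A ⟨k.natAbs, h⟩)ᴴ
  else 0

/-- The value `A(ζ) = ∑_{k=-n}^{n} A_k ζ^{-k}` of the pseudo-polynomial with coefficients `A`. -/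
def symbol {m n : ℕ} (A : Coeffs m n) (z : ℂ) : Matrix (Fin m) (Fin m) ℂ :=
  ∑ k ∈ Finset.Icc (-(n : ℤ)) (n : ℤ), z ^ (-k) • coeff A k

/-- The grid angle `θ_j = j π / N`. -/
def angle (N : ℕ) (j : ℤ) : ℝ := (j : ℝ) * Real.pi / (N : ℝ)

/-- The discrete unit circle `𝕋_{2N} = {ζ_{-N+1}, …, ζ_N}`, where `ζ_j = e^{i j π / N}`. -/
def discreteCircle (N : ℕ) : Set ℂ :=
  {z | ∃ j ∈ Finset.Icc (-(N : ℤ) + 1) (N : ℤ), z = Complex.exp (Complex.I * (angle N j : ℂ))}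

/-- The measure `ν` in the variable `θ ∈ (-π, π]`, with mass `1 / (2N)` at each angle `j π / N`,
`j = -N+1, …, N`. -/
def nu (N : ℕ) : MeasureTheory.Measure ℝ :=
  ∑ j ∈ Finset.Icc (-(N : ℤ) + 1) (N : ℤ),
    (2 * (N : ENNReal))⁻¹ • MeasureTheory.Measure.dirac (angle N j)

/-- The cone of Hermitian `m × m` pseudo-polynomials of degree at most `n` (the condition
`A_{-k} = A_k^*` for `k = 0` says that `A_0` is Hermitian) that are positive definite on the
discrete unit circle. -/
def PPlus (m n N : ℕ) : Set (Coeffs m n) :=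
  {Q | (Q 0).IsHermitian ∧ ∀ z ∈ discreteCircle N, (symbol Q z).PosDef}

/-- The pairing `⟨C, Q⟩ = ∑_{k=-n}^{n} tr (C_k Q_k^*)`. -/
def pairing {m n : ℕ} (C Q : Coeffs m n) : ℂ :=
  ∑ k ∈ Finset.Icc (-(n : ℤ)) (n : ℤ), (coeff C k * (coeff Q k)ᴴ).trace

/-- The dual cone of all `C = (C_0, …, C_n)` (with `C_{-k} = C_k^*`, so `C_0` is Hermitian) such
that `⟨C, Q⟩ > 0` for all nonzero `Q` in the closure of `PPlus m n N`. -/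
def CPlus (m n N : ℕ) : Set (Coeffs m n) :=
  {C | (C 0).IsHermitian ∧ ∀ Q ∈ closure (PPlus m n N) \ {0}, 0 < pairing C Q}

/-- `Φ(ζ) = P(ζ) Q(ζ)⁻¹`, with scalar `P`, that is, a `1 × 1` matrix identified with its entry. -/
def Phi {m n : ℕ} (P : Coeffs 1 n) (Q : Coeffs m n) (z : ℂ) : Matrix (Fin m) (Fin m) ℂ :=
  (symbol P z 0 0) • (symbol Q z)⁻¹

/-- The matrix moment `∫_{-π}^{π} e^{i k θ} F(e^{i θ}) dν(θ)`, computed entrywise. -/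
def moment {m : ℕ} (N : ℕ) (F : ℂ → Matrix (Fin m) (Fin m) ℂ) (k : ℕ) :
    Matrix (Fin m) (Fin m) ℂ :=
  Matrix.of fun a b => ∫ θ in (-Real.pi)..Real.pi,
    Complex.exp (Complex.I * (k : ℂ) * (θ : ℂ)) * F (Complex.exp (Complex.I * (θ : ℂ))) a b ∂(nu N)

end CirculantExt

end

/-!
The solution `Q` is found variationally. With the weights
`a_j = P(ζ_j) / (2N) > 0`, the moment conditions are the stationarity equations of
`Q ↦ ∑_j a_j log det Q(ζ_j) - ⟨C, Q⟩` on the cone: by Jacobi's formula the derivative in a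
direction `H` is `∑_j a_j tr (Q(ζ_j)⁻¹ H(ζ_j)) - ⟨C, H⟩`, and by Parseval's identity
(`pairing_momentCoeffs`) the first sum is the pairing of `H` with the moments of `P Q⁻¹`. As the
pairing is definite, stationarity in the direction `H = C - (moments)` forces `H = 0`.

A maximiser exists by compactness. Maximising first over each ray leaves, up to a constant, the logarithm
of `detRatio`, which is homogeneous of degree zero, so it suffices to maximise `detRatio` over the
intersection of the closed cone with a sphere, where `⟨C, ·⟩` is continuous and positive. Because `ν` is discrete and
`P > 0` on its support, `detRatio` extends continuously by zero to the boundary of the cone, so the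
maximiser is interior (`exists_isMaxOn_detRatio`); rescaling it gives `Q`.

For uniqueness, two solutions `Q`, `R` satisfy
`∑_j a_j tr ((Q(ζ_j)⁻¹ - R(ζ_j)⁻¹) (R(ζ_j) - Q(ζ_j))) = 0`. The terms are nonnegative and vanish only
if `Q(ζ_j) = R(ζ_j)` (`trace_inv_sub_inv_mul_sub`), and for `n < N` a pseudo-polynomial of degree at
most `n` is determined by its values on the discrete circle (`momentCoeffs_symbol`).
-/

namespace CirculantExt

variable {m n N : ℕ}

/-! ### Coefficients, symbols and the pairing -/

lemma coeff_natCast (A : Coeffs m n) (k : Fin (n + 1)) : coeff A (k : ℕ) = A k := by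
  simp [coeff, k.2]

lemma coeff_neg {A : Coeffs m n} (hA : (A 0).IsHermitian) (k : ℤ) :
    coeff A (-k) = (coeff A k)ᴴ := by
  rcases lt_trichotomy k 0 with h | rfl | h
  · simp only [coeff, Int.natAbs_neg]
    split_ifs <;> first | omega | simp
  · simpa [coeff] using hA.eq.symm
  · simp only [coeff, Int.natAbs_neg]
    split_ifs <;> first | omega | simp

lemma coeff_add (A B : Coeffs m n) (k : ℤ) : coeff (A + B) k = coeff A k + coeff B k := by
  unfold coeff
  split_ifs <;> simp

lemma coeff_smul (r : ℝ) (A : Coeffs m n) (k : ℤ) : coeff (r • A) k = r • coeff A k := by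
  unfold coeff
  split_ifs <;> simp [Matrix.conjTranspose_smul]

lemma coeff_sub (A B : Coeffs m n) (k : ℤ) : coeff (A - B) k = coeff A k - coeff B k := by
  unfold coeff
  split_ifs <;> simp

lemma symbol_add (A B : Coeffs m n) (z : ℂ) : symbol (A + B) z = symbol A z + symbol B z := by
  simp [symbol, coeff_add, Finset.sum_add_distrib]

lemma symbol_sub (A B : Coeffs m n) (z : ℂ) : symbol (A - B) z = symbol A z - symbol B z := by
  simp [symbol, coeff_sub, smul_sub, Finset.sum_sub_distrib]

lemma symbol_smul (r : ℝ) (A : Coeffs m n) (z : ℂ) : symbol (r • A) z = r • symbol A z := by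
  simp only [symbol, coeff_smul, Finset.smul_sum]
  exact Finset.sum_congr rfl fun k _ => smul_comm _ _ _

lemma pairing_add_right (C A B : Coeffs m n) :
    pairing C (A + B) = pairing C A + pairing C B := by
  simp [pairing, coeff_add, mul_add, Finset.sum_add_distrib]

lemma pairing_smul_right (r : ℝ) (C A : Coeffs m n) : pairing C (r • A) = r * pairing C A := by
  simp [pairing, coeff_smul, Finset.mul_sum, Matrix.conjTranspose_smul, Matrix.trace_smul]

lemma pairing_sub_left (C D A : Coeffs m n) :
    pairing (C - D) A = pairing C A - pairing D A := by
  simp [pairing, coeff_sub, sub_mul, Finset.sum_sub_distrib]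

@[fun_prop]
lemma continuous_coeff (k : ℤ) : Continuous fun A : Coeffs m n => coeff A k := by
  unfold coeff
  split_ifs <;> fun_prop

@[fun_prop]
lemma continuous_symbol (z : ℂ) : Continuous fun A : Coeffs m n => symbol A z := by
  unfold symbol
  fun_prop

@[fun_prop]
lemma continuous_pairing (C : Coeffs m n) : Continuous fun A : Coeffs m n => pairing C A := by
  unfold pairing
  fun_prop

/-- The pairing is definite: its diagonal is the sum of the squared Frobenius norms of the
coefficients. -/
lemma eq_zero_of_re_pairing_self {D : Coeffs m n} (h : (pairing D D).re = 0) : D = 0 := by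
  have hnn : ∀ k : ℤ, 0 ≤ (coeff D k * (coeff D k)ᴴ).trace.re := fun k =>
    (Complex.nonneg_iff.1 (Matrix.posSemidef_self_mul_conjTranspose (coeff D k)).trace_nonneg).1
  have him : ∀ k : ℤ, 0 = (coeff D k * (coeff D k)ᴴ).trace.im := fun k =>
    (Complex.nonneg_iff.1 (Matrix.posSemidef_self_mul_conjTranspose (coeff D k)).trace_nonneg).2
  rw [pairing, Complex.re_sum, Finset.sum_eq_zero_iff_of_nonneg fun k _ => hnn k] at h
  funext k
  have hk := h (k : ℕ) (by simp; omega)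
  rw [← coeff_natCast D k]
  exact Matrix.trace_mul_conjTranspose_self_eq_zero_iff.1 (Complex.ext hk (him _).symm)

/-! ### Points of the discrete circle and moments -/

/-- The indices `-N+1, …, N` of the points of the discrete circle. -/
noncomputable abbrev gridIndex (N : ℕ) : Finset ℤ := Finset.Icc (-(N : ℤ) + 1) (N : ℤ)

/-- The point `ζ_j = e^{ijπ/N}`. -/
noncomputable def gridPoint (N : ℕ) (j : ℤ) : ℂ := Complex.exp (Complex.I * (angle N j : ℂ))

lemma gridPoint_ne_zero (N : ℕ) (j : ℤ) : gridPoint N j ≠ 0 := Complex.exp_ne_zero _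

lemma gridPoint_mem {j : ℤ} (hj : j ∈ gridIndex N) : gridPoint N j ∈ discreteCircle N :=
  ⟨j, hj, rfl⟩

lemma star_gridPoint_zpow (N : ℕ) (j k : ℤ) :
    star (gridPoint N j ^ k) = gridPoint N j ^ (-k) := by
  have h : star (gridPoint N j) = (gridPoint N j)⁻¹ := by
    simp [gridPoint, ← Complex.exp_conj, ← Complex.exp_neg]
  rw [star_zpow₀, h, inv_zpow']

lemma gridPoint_eq_zpow (N : ℕ) (j : ℤ) : gridPoint N j = gridPoint N 1 ^ j := by
  rw [gridPoint, gridPoint, ← Complex.exp_int_mul]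
  congr 1
  simp [angle]
  ring

lemma gridPoint_one_eq (N : ℕ) :
    gridPoint N 1 = Complex.exp (2 * Real.pi * Complex.I / ((2 * N : ℕ) : ℂ)) := by
  rw [gridPoint]
  congr 1
  rcases eq_or_ne N 0 with rfl | h
  · simp [angle]
  · have : (N : ℂ) ≠ 0 := by exact_mod_cast h
    simp [angle]
    field_simp

/-- Orthogonality of the characters `z ↦ z ^ k` on the discrete circle. -/
lemma sum_gridPoint_zpow (hN : 0 < N) (k : ℤ) (hk : |k| < 2 * N) :
    ∑ j ∈ gridIndex N, gridPoint N j ^ k = if k = 0 then (2 * N : ℂ) else 0 := by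
  split_ifs with h0
  · subst h0
    simp
    have : ((N : ℤ) + N).toNat = 2 * N := by omega
    rw [this]
    push_cast
    ring
  have hprim : IsPrimitiveRoot (gridPoint N 1) (2 * N) := by
    rw [gridPoint_one_eq]
    exact Complex.isPrimitiveRoot_exp (2 * N) (by omega)
  set w := gridPoint N 1 ^ k with hw
  have hw1 : w ≠ 1 := by
    intro h
    have hd := (hprim.zpow_eq_one_iff_dvd k).1 h
    exact h0 (Int.eq_zero_of_abs_lt_dvd hd (by push_cast; exact hk))
  have hw0 : w ≠ 0 := zpow_ne_zero _ (gridPoint_ne_zero _ _)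
  have hwN : w ^ (2 * N : ℤ) = 1 := by
    rw [hw, ← zpow_mul, mul_comm, zpow_mul]
    have := hprim.zpow_eq_one
    push_cast at this
    rw [this, one_zpow]
  have hS : ∑ j ∈ gridIndex N, gridPoint N j ^ k = ∑ j ∈ gridIndex N, w ^ j := by
    refine Finset.sum_congr rfl fun j _ => ?_
    rw [gridPoint_eq_zpow, hw, ← zpow_mul, ← zpow_mul, mul_comm]
  rw [hS]
  -- reindex from `0, …, 2N-1` and sum the geometric series
  have hR : ∑ j ∈ gridIndex N, w ^ j = ∑ i ∈ Finset.range (2 * N), w ^ (-(N : ℤ) + 1) * w ^ i := by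
    symm
    refine Finset.sum_bij (fun i _ => (i : ℤ) + (-(N : ℤ) + 1)) ?_ ?_ ?_ ?_
    · intro i hi
      simp at hi ⊢
      omega
    · intro a _ b _ h
      simpa using h
    · intro b hb
      simp at hb
      exact ⟨(b - (-(N : ℤ) + 1)).toNat, by simp; omega, by omega⟩
    · intro i _
      rw [zpow_add₀ hw0 (i : ℤ), zpow_natCast, mul_comm]
  have hpow : w ^ (2 * N) = 1 := by exact_mod_cast hwN
  rw [hR, ← Finset.mul_sum, geom_sum_eq hw1, hpow]
  simp

lemma symbol_isHermitian {A : Coeffs m n} (hA : (A 0).IsHermitian) (j : ℤ) :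
    (symbol A (gridPoint N j)).IsHermitian := by
  rw [Matrix.IsHermitian, symbol, Matrix.conjTranspose_sum]
  refine Finset.sum_bij (fun k _ => -k) ?_ ?_ ?_ ?_
  · intro k hk
    simp at hk ⊢
    omega
  · intro a _ b _ h
    simpa using h
  · intro b hb
    simp at hb
    exact ⟨-b, by simp; omega, by simp⟩
  · intro k _
    rw [Matrix.conjTranspose_smul, star_gridPoint_zpow, coeff_neg hA]

/-- All atoms of `ν` lie in the half-open interval over which the interval integral is taken; the
index `-N`, with angle `-π`, is not among them. -/
lemma angle_mem_Ioc (hN : 0 < N) {j : ℤ} (hj : j ∈ gridIndex N) :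
    angle N j ∈ Set.Ioc (-Real.pi) Real.pi := by
  have hN' : (0 : ℝ) < N := by exact_mod_cast hN
  obtain ⟨h1, h2⟩ := Finset.mem_Icc.1 hj
  have h1' : (-(N : ℝ)) < j := by exact_mod_cast (by omega : -(N : ℤ) < j)
  have h2' : (j : ℝ) ≤ N := by exact_mod_cast h2
  constructor
  · rw [angle, lt_div_iff₀ hN']
    nlinarith [Real.pi_pos]
  · rw [angle, div_le_iff₀ hN']
    nlinarith [Real.pi_pos]

/-- The moments are finite sums over the discrete circle. -/
lemma moment_eq_sum (hN : 0 < N) (F : ℂ → Matrix (Fin m) (Fin m) ℂ) (k : ℕ) :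
    moment N F k =
      ∑ j ∈ gridIndex N, (2 * N : ℝ)⁻¹ • gridPoint N j ^ (k : ℤ) • F (gridPoint N j) := by
  ext a b
  rw [moment, Matrix.of_apply, intervalIntegral.integral_of_le (by linarith [Real.pi_pos]), nu,
    ← MeasureTheory.Measure.restrictₗ_apply, map_sum]
  simp only [MeasureTheory.Measure.restrictₗ_apply]
  have hfin : ∀ j ∈ gridIndex N, MeasureTheory.Integrable
      (fun θ : ℝ => Complex.exp (Complex.I * (k : ℂ) * (θ : ℂ)) *
        F (Complex.exp (Complex.I * (θ : ℂ))) a b)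
      (((2 * (N : ENNReal))⁻¹ • MeasureTheory.Measure.dirac (angle N j)).restrict
        (Set.Ioc (-Real.pi) Real.pi)) := by
    intro j _
    refine MeasureTheory.Integrable.restrict ?_
    refine MeasureTheory.Integrable.smul_measure ?_ (by simp; omega)
    exact MeasureTheory.integrable_dirac (by simpa using ENNReal.mul_lt_top (by simp) (by simp))
  rw [MeasureTheory.integral_finsetSum_measure hfin, Matrix.sum_apply]
  refine Finset.sum_congr rfl fun j hj => ?_
  rw [MeasureTheory.Measure.restrict_smul, MeasureTheory.integral_smul_measure,
    MeasureTheory.restrict_dirac' measurableSet_Ioc, if_pos (angle_mem_Ioc hN hj),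
    MeasureTheory.integral_dirac]
  have : Complex.exp (Complex.I * (k : ℂ) * (angle N j : ℂ)) = gridPoint N j ^ (k : ℤ) := by
    rw [gridPoint, ← Complex.exp_int_mul]
    congr 1
    push_cast
    ring
  rw [this]
  simp [gridPoint]

/-- The moments of `F` of index `0, …, n`. -/
noncomputable def momentCoeffs (n N : ℕ) (F : ℂ → Matrix (Fin m) (Fin m) ℂ) : Coeffs m n :=
  fun k => moment N F k

/-- For Hermitian values the moments of negative index are the adjoints of those of positive
index, so that the Hermitian extension of the moment sequence is again a moment sequence. -/
lemma coeff_momentCoeffs (hN : 0 < N) {F : ℂ → Matrix (Fin m) (Fin m) ℂ}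
    (hF : ∀ j ∈ gridIndex N, (F (gridPoint N j)).IsHermitian) {k : ℤ} (hk : k.natAbs < n + 1) :
    coeff (momentCoeffs n N F) k =
      ∑ j ∈ gridIndex N, (2 * N : ℝ)⁻¹ • gridPoint N j ^ k • F (gridPoint N j) := by
  rw [coeff, dif_pos hk]
  split_ifs with h0
  · simp only [momentCoeffs, moment_eq_sum hN]
    rw [Int.natAbs_of_nonneg h0]
  · simp only [momentCoeffs, moment_eq_sum hN, Matrix.conjTranspose_sum]
    refine Finset.sum_congr rfl fun j hj => ?_
    rw [Matrix.conjTranspose_smul, Matrix.conjTranspose_smul, star_gridPoint_zpow, (hF j hj).eq,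
      star_trivial]
    congr 3
    omega

lemma momentCoeffs_zero_isHermitian (hN : 0 < N) {F : ℂ → Matrix (Fin m) (Fin m) ℂ}
    (hF : ∀ j ∈ gridIndex N, (F (gridPoint N j)).IsHermitian) :
    (momentCoeffs n N F 0).IsHermitian := by
  simp only [momentCoeffs, moment_eq_sum hN, Matrix.IsHermitian, Matrix.conjTranspose_sum]
  refine Finset.sum_congr rfl fun j hj => ?_
  rw [Matrix.conjTranspose_smul, Matrix.conjTranspose_smul, (hF j hj).eq]
  simp

/-- Parseval's identity: the pairing with a moment sequence is a sum over the discrete circle. -/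
lemma pairing_momentCoeffs (hN : 0 < N) {F : ℂ → Matrix (Fin m) (Fin m) ℂ}
    (hF : ∀ j ∈ gridIndex N, (F (gridPoint N j)).IsHermitian) (H : Coeffs m n)
    (hH : (H 0).IsHermitian) :
    pairing (momentCoeffs n N F) H =
      ∑ j ∈ gridIndex N,
        (2 * N : ℝ)⁻¹ • (F (gridPoint N j) * symbol H (gridPoint N j)).trace := by
  have h1 : ∀ j, symbol H (gridPoint N j) =
      ∑ k ∈ Finset.Icc (-(n : ℤ)) n, gridPoint N j ^ k • (coeff H k)ᴴ := by
    intro j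
    rw [← (symbol_isHermitian (N := N) hH j).eq, symbol, Matrix.conjTranspose_sum]
    refine Finset.sum_congr rfl fun k _ => ?_
    rw [Matrix.conjTranspose_smul, star_gridPoint_zpow, neg_neg]
  simp_rw [h1, Finset.mul_sum, Matrix.trace_sum, Finset.smul_sum]
  rw [Finset.sum_comm, pairing]
  refine Finset.sum_congr rfl fun k hk => ?_
  rw [coeff_momentCoeffs hN hF (by simp at hk; omega), Finset.sum_mul, Matrix.trace_sum]
  refine Finset.sum_congr rfl fun j _ => ?_
  simp [Matrix.trace_smul]

/-- Discrete Fourier inversion. The degree bound `n < N` rules out aliasing. -/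
lemma momentCoeffs_symbol (hnN : n < N) (A : Coeffs m n) : momentCoeffs n N (symbol A) = A := by
  have hN : 0 < N := by omega
  funext k
  simp only [momentCoeffs, moment_eq_sum hN, symbol, Finset.smul_sum]
  rw [Finset.sum_comm]
  have h : ∀ l ∈ Finset.Icc (-(n : ℤ)) n,
      ∑ j ∈ gridIndex N, (2 * N : ℝ)⁻¹ • gridPoint N j ^ ((k : ℕ) : ℤ) •
        gridPoint N j ^ (-l) • coeff A l = if l = (k : ℕ) then coeff A l else 0 := by
    intro l hl
    have hl' := Finset.mem_Icc.1 hl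
    have hk := k.2
    simp_rw [smul_smul, ← zpow_add₀ (gridPoint_ne_zero N _)]
    rw [← Finset.smul_sum, ← Finset.sum_smul,
      sum_gridPoint_zpow hN _ (by rw [abs_lt]; omega)]
    have hN' : (N : ℂ) ≠ 0 := by exact_mod_cast hN.ne'
    by_cases hlk : l = (k : ℕ)
    · subst hlk
      ext a b
      simp
      field_simp
    · rw [if_neg (by omega), if_neg hlk]
      simp
  rw [Finset.sum_congr rfl h, Finset.sum_ite_eq', if_pos (by simp; omega), coeff_natCast]

lemma eq_zero_of_symbol_eq_zero (hnN : n < N) {A : Coeffs m n}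
    (h : ∀ j ∈ gridIndex N, symbol A (gridPoint N j) = 0) : A = 0 := by
  rw [← momentCoeffs_symbol hnN A]
  funext k
  rw [momentCoeffs, moment_eq_sum (by omega)]
  exact Finset.sum_eq_zero fun j hj => by simp [h j hj]

/-! ### Positive definite matrices -/

open scoped MatrixOrder Matrix.Norms.L2Operator in
/-- For `E = B - A` the trace is the squared Frobenius norm of `S E Tᴴ`, where `A⁻¹ = Sᴴ S` and
`B⁻¹ = Tᴴ T`. -/
lemma trace_inv_sub_inv_mul_sub {A B : Matrix (Fin m) (Fin m) ℂ} (hA : A.PosDef) (hB : B.PosDef) :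
    0 ≤ ((A⁻¹ - B⁻¹) * (B - A)).trace ∧ (((A⁻¹ - B⁻¹) * (B - A)).trace = 0 → A = B) := by
  have hAu : IsUnit A.det := (Matrix.isUnit_iff_isUnit_det _).1 hA.isUnit
  have hBu : IsUnit B.det := (Matrix.isUnit_iff_isUnit_det _).1 hB.isUnit
  -- The factorizations come from the C⋆-algebra structure of the operator norm.
  obtain ⟨S, hS : A⁻¹ = Sᴴ * S⟩ :=
    CStarAlgebra.nonneg_iff_eq_star_mul_self.1 hA.inv.posSemidef.nonneg
  obtain ⟨T, hT : B⁻¹ = Tᴴ * T⟩ :=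
    CStarAlgebra.nonneg_iff_eq_star_mul_self.1 hB.inv.posSemidef.nonneg
  have hE : (B - A)ᴴ = B - A := (hB.isHermitian.sub hA.isHermitian).eq
  have hdiff : A⁻¹ - B⁻¹ = A⁻¹ * (B - A) * B⁻¹ := by
    rw [Matrix.mul_sub, Matrix.sub_mul, Matrix.nonsing_inv_mul _ hAu, Matrix.one_mul,
      Matrix.mul_assoc, Matrix.mul_nonsing_inv _ hBu, Matrix.mul_one]
  have key : ((A⁻¹ - B⁻¹) * (B - A)).trace =
      ((S * (B - A) * Tᴴ) * (S * (B - A) * Tᴴ)ᴴ).trace := by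
    rw [hdiff, hS, hT, Matrix.conjTranspose_mul, Matrix.conjTranspose_mul, hE,
      Matrix.conjTranspose_conjTranspose]
    simp only [Matrix.mul_assoc]
    rw [Matrix.trace_mul_comm]
    simp only [Matrix.mul_assoc]
  rw [key]
  refine ⟨(Matrix.posSemidef_self_mul_conjTranspose _).trace_nonneg, fun h => ?_⟩
  have hW := Matrix.trace_mul_conjTranspose_self_eq_zero_iff.1 h
  have h0 : A⁻¹ - B⁻¹ = 0 := by
    rw [hdiff, hS, hT]
    calc Sᴴ * S * (B - A) * (Tᴴ * T) = Sᴴ * (S * (B - A) * Tᴴ) * T := by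
          simp only [Matrix.mul_assoc]
      _ = 0 := by rw [hW]; simp
  have h1 : A⁻¹ = B⁻¹ := sub_eq_zero.1 h0
  rw [← Matrix.nonsing_inv_nonsing_inv A hAu, h1, Matrix.nonsing_inv_nonsing_inv B hBu]

/-- Positive definiteness is an open condition along Hermitian lines, by compactness of the unit
sphere. -/
lemma eventually_posDef_add_smul {A H : Matrix (Fin m) (Fin m) ℂ} (hA : A.PosDef)
    (hH : H.IsHermitian) : ∀ᶠ t : ℝ in nhds 0, (A + t • H).PosDef := by
  have hcont : Continuous fun q : ℝ × (Fin m → ℂ) =>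
      (star q.2 ⬝ᵥ ((A + q.1 • H) *ᵥ q.2)).re := by
    fun_prop
  have hev : ∀ᶠ t : ℝ in nhds 0, ∀ x ∈ Metric.sphere (0 : Fin m → ℂ) 1,
      0 < (star x ⬝ᵥ ((A + t • H) *ᵥ x)).re := by
    refine (isCompact_sphere _ _).eventually_forall_of_forall_eventually fun x hx => ?_
    refine continuousAt_const.eventually_lt hcont.continuousAt ?_
    have hx0 : x ≠ 0 := by
      rintro rfl
      simp at hx
    simpa using hA.re_dotProduct_pos hx0
  filter_upwards [hev] with t ht
  have hherm : (A + t • H).IsHermitian := by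
    rw [Matrix.IsHermitian, Matrix.conjTranspose_add, Matrix.conjTranspose_smul, hA.isHermitian.eq,
      hH.eq, star_trivial]
  refine Matrix.PosDef.of_dotProduct_mulVec_pos hherm fun x hx => ?_
  have hpos := ht ((‖x‖⁻¹ : ℝ) • x) (by simp [norm_smul, hx])
  have him : (star x ⬝ᵥ ((A + t • H) *ᵥ x)).im = 0 := hherm.im_star_dotProduct_mulVec_self x
  rw [Complex.pos_iff]
  refine ⟨?_, him.symm⟩
  have hn : 0 < ‖x‖⁻¹ := by positivity
  rw [star_smul, Matrix.mulVec_smul, smul_dotProduct, dotProduct_smul, star_trivial,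
    Complex.smul_re, Complex.smul_re, smul_eq_mul, smul_eq_mul] at hpos
  exact (pos_iff_pos_of_mul_pos ((pos_iff_pos_of_mul_pos hpos).1 hn |> fun h => mul_pos hn
    ((pos_iff_pos_of_mul_pos h).1 hn))).1 hn

/-- Jacobi's formula at an invertible matrix. -/
lemma hasDerivAt_det_add_smul {A : Matrix (Fin m) (Fin m) ℂ} (hA : IsUnit A.det)
    (H : Matrix (Fin m) (Fin m) ℂ) :
    HasDerivAt (fun t : ℝ => (A + t • H).det) (A.det * (A⁻¹ * H).trace) 0 := by
  have hfac : ∀ t : ℝ, (A + t • H).det = A.det * (1 + (t : ℂ) • (A⁻¹ * H)).det := by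
    intro t
    rw [← Matrix.det_mul, Matrix.mul_add, Matrix.mul_one, Matrix.mul_smul, ← Matrix.mul_assoc,
      Matrix.mul_nonsing_inv _ hA, Matrix.one_mul]
    congr 2
  simp only [hfac]
  conv => enter [1, t]; rw [Matrix.det_one_add_smul]
  generalize (Matrix.det (1 + (Polynomial.X : Polynomial ℂ) •
    (A⁻¹ * H).map Polynomial.C)).divX.divX = p
  have hc : HasDerivAt (fun z : ℂ => A.det * (1 + (A⁻¹ * H).trace * z + p.eval z * z ^ 2))
      (A.det * (A⁻¹ * H).trace) (0 : ℝ) := by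
    have h := (((hasDerivAt_id (0 : ℂ)).const_mul (A⁻¹ * H).trace).const_add 1).add
      ((p.hasDerivAt 0).mul ((hasDerivAt_id (0 : ℂ)).pow 2)) |>.const_mul A.det
    simpa using h
  exact hc.comp_ofReal

lemma hasDerivAt_log_det_add_smul {A : Matrix (Fin m) (Fin m) ℂ} (hA : A.PosDef)
    (H : Matrix (Fin m) (Fin m) ℂ) :
    HasDerivAt (fun t : ℝ => Real.log (A + t • H).det.re) (A⁻¹ * H).trace.re 0 := by
  obtain ⟨hre, him⟩ := Complex.pos_iff.1 hA.det_pos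
  have hd := hasDerivAt_det_add_smul ((Matrix.isUnit_iff_isUnit_det _).1 hA.isUnit) H
  have hr : HasDerivAt (fun t : ℝ => (A + t • H).det.re) (A.det * (A⁻¹ * H).trace).re 0 :=
    Complex.reCLM.hasFDerivAt.comp_hasDerivAt (0 : ℝ) hd
  have hl := hr.log (by simpa using hre.ne')
  convert hl using 1
  rw [Complex.mul_re, ← him]
  simp
  field_simp

/-! ### The cone of positive pseudo-polynomials -/

lemma isClosed_posSemidef : IsClosed {A : Matrix (Fin m) (Fin m) ℂ | A.PosSemidef} := by
  simp only [Matrix.posSemidef_iff_dotProduct_mulVec, Set.ofPred_and, Set.ofPred_forall]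
  refine IsClosed.inter ?_ (isClosed_iInter fun x => ?_)
  · exact isClosed_eq (by fun_prop) continuous_id
  · exact isClosed_le continuous_const (by fun_prop)

lemma posSemidef_of_mem_closure {Q : Coeffs m n} (hQ : Q ∈ closure (PPlus m n N)) {z : ℂ}
    (hz : z ∈ discreteCircle N) : (symbol Q z).PosSemidef :=
  closure_minimal (fun _ hV => (hV.2 z hz).posSemidef)
    (isClosed_posSemidef.preimage (continuous_symbol z)) hQ

lemma isHermitian_of_mem_closure {Q : Coeffs m n} (hQ : Q ∈ closure (PPlus m n N)) :
    (Q 0).IsHermitian :=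
  closure_minimal (fun _ hV => hV.1)
    (isClosed_eq (by fun_prop) (by fun_prop) : IsClosed {Q : Coeffs m n | (Q 0)ᴴ = Q 0}) hQ

lemma smul_mem_PPlus {Q : Coeffs m n} (hQ : Q ∈ PPlus m n N) {r : ℝ} (hr : 0 < r) :
    r • Q ∈ PPlus m n N := by
  constructor
  · simp only [Pi.smul_apply, Matrix.IsHermitian, Matrix.conjTranspose_smul, star_trivial, hQ.1.eq]
  · intro z hz
    rw [symbol_smul]
    exact (hQ.2 z hz).smul hr

lemma eventually_add_smul_mem_PPlus {Q H : Coeffs m n} (hQ : Q ∈ PPlus m n N)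
    (hH : (H 0).IsHermitian) : ∀ᶠ t : ℝ in nhds 0, Q + t • H ∈ PPlus m n N := by
  have h1 : ∀ᶠ t : ℝ in nhds 0, ∀ j ∈ gridIndex N,
      (symbol Q (gridPoint N j) + t • symbol H (gridPoint N j)).PosDef :=
    (Filter.eventually_all_finset _).2 fun j hj =>
      eventually_posDef_add_smul (hQ.2 _ (gridPoint_mem hj)) (symbol_isHermitian hH j)
  filter_upwards [h1] with t ht
  constructor
  · simp only [Pi.add_apply, Pi.smul_apply, Matrix.IsHermitian, Matrix.conjTranspose_add,
      Matrix.conjTranspose_smul, star_trivial, hQ.1.eq, hH.eq]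
  · rintro z ⟨j, hj, rfl⟩
    rw [symbol_add, symbol_smul]
    exact ht j hj

/-- The constant pseudo-polynomial with value the identity matrix. -/
def constOne (m n : ℕ) : Coeffs m n := Pi.single 0 1

lemma constOne_mem_PPlus : constOne m n ∈ PPlus m n N := by
  have hc : ∀ k : ℤ, coeff (constOne m n) k = if k = 0 then 1 else 0 := by
    intro k
    rcases eq_or_ne k 0 with rfl | hk
    · simp [coeff, constOne]
    · have : ∀ h : k.natAbs < n + 1, (⟨k.natAbs, h⟩ : Fin (n + 1)) ≠ 0 := by
        intro h h'
        have := congrArg Fin.val h'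
        simp at this
        exact hk this
      unfold coeff
      split_ifs <;> simp [constOne, this]
  constructor
  · simp [constOne, Matrix.isHermitian_one]
  · intro z _
    have : symbol (constOne m n) z = 1 := by
      rw [symbol, Finset.sum_eq_single 0]
      · simp [hc]
      · intro k _ hk
        simp [hc, hk]
      · simp
    rw [this]
    exact Matrix.PosDef.one

lemma ne_zero_of_mem_PPlus [NeZero m] (hN : 0 < N) {Q : Coeffs m n} (hQ : Q ∈ PPlus m n N) :
    Q ≠ 0 := by
  rintro rfl
  have h := (hQ.2 _ (gridPoint_mem (N := N) (j := N) (by simp; omega))).det_pos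
  have h0 : symbol (0 : Coeffs m n) (gridPoint N N) = 0 := by
    simpa using symbol_smul 0 (0 : Coeffs m n) (gridPoint N N)
  rw [h0, Matrix.det_zero] at h
  exact lt_irrefl _ h

lemma re_pairing_pos {C Q : Coeffs m n} (hC : C ∈ CPlus m n N) (hQ : Q ∈ closure (PPlus m n N))
    (h0 : Q ≠ 0) : 0 < (pairing C Q).re :=
  (Complex.pos_iff.1 (hC.2 Q ⟨hQ, h0⟩)).1

/-! ### The scale-invariant determinant functional -/

/-- The functional `V ↦ ∏_j det V(ζ_j) ^ a_j / ⟨C, V⟩ ^ (m ∑_j a_j)`, homogeneous of degree `0`.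
Its logarithm is, up to a constant, the maximum over `r > 0` of
`∑_j a_j log det (r V(ζ_j)) - ⟨C, r V⟩`. -/
noncomputable def detRatio (N : ℕ) (C : Coeffs m n) (a : ℤ → ℝ) (V : Coeffs m n) : ℝ :=
  (∏ j ∈ gridIndex N, (symbol V (gridPoint N j)).det.re ^ a j) /
    (pairing C V).re ^ (m * ∑ j ∈ gridIndex N, a j)

lemma det_real_smul (r : ℝ) (A : Matrix (Fin m) (Fin m) ℂ) :
    (r • A).det.re = r ^ m * A.det.re := by
  have : r • A = (r : ℂ) • A := by
    ext
    simp
  rw [this, Matrix.det_smul, Fintype.card_fin, ← Complex.ofReal_pow, Complex.re_ofReal_mul]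

lemma detRatio_smul {C V : Coeffs m n} (hC : C ∈ CPlus m n N) (hV : V ∈ closure (PPlus m n N))
    (hV0 : V ≠ 0) (a : ℤ → ℝ) {r : ℝ} (hr : 0 < r) :
    detRatio N C a (r • V) = detRatio N C a V := by
  have hc := re_pairing_pos hC hV hV0
  have hd : ∀ j ∈ gridIndex N, (symbol (r • V) (gridPoint N j)).det.re ^ a j =
      (r ^ m) ^ a j * (symbol V (gridPoint N j)).det.re ^ a j := by
    intro j hj
    rw [symbol_smul, det_real_smul, Real.mul_rpow (by positivity)]
    exact (Complex.nonneg_iff.1 (posSemidef_of_mem_closure hV (gridPoint_mem hj)).det_nonneg).1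
  have hpow : ∏ j ∈ gridIndex N, (r ^ m) ^ a j = r ^ (m * ∑ j ∈ gridIndex N, a j) := by
    rw [Real.rpow_mul hr.le, Real.rpow_natCast, Real.rpow_sum_of_pos (by positivity)]
  rw [detRatio, Finset.prod_congr rfl hd, Finset.prod_mul_distrib, hpow, pairing_smul_right,
    Complex.re_ofReal_mul, Real.mul_rpow hr.le hc.le, detRatio,
    mul_div_mul_left _ _ (Real.rpow_pos_of_pos hr _).ne']

lemma detRatio_pos [NeZero m] (hN : 0 < N) {C V : Coeffs m n} (hC : C ∈ CPlus m n N)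
    (hV : V ∈ PPlus m n N) (a : ℤ → ℝ) : 0 < detRatio N C a V :=
  div_pos
    (Finset.prod_pos fun _ hj => Real.rpow_pos_of_pos
      (Complex.pos_iff.1 (hV.2 _ (gridPoint_mem hj)).det_pos).1 _)
    (Real.rpow_pos_of_pos (re_pairing_pos hC (subset_closure hV) (ne_zero_of_mem_PPlus hN hV)) _)

open scoped Matrix.Norms.Elementwise in
/-- By homogeneity it suffices to maximise over the compact intersection of the closed cone with
the unit sphere; the maximiser is not on the boundary because the functional vanishes there. -/
lemma exists_isMaxOn_detRatio [NeZero m] (hN : 0 < N) {C : Coeffs m n} (hC : C ∈ CPlus m n N)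
    {a : ℤ → ℝ} (ha : ∀ j ∈ gridIndex N, 0 < a j) :
    ∃ U ∈ PPlus m n N, IsMaxOn (detRatio N C a) (PPlus m n N) U := by
  have hK : IsCompact (Metric.sphere (0 : Coeffs m n) 1 ∩ closure (PPlus m n N)) :=
    (isCompact_sphere _ _).inter_right isClosed_closure
  have hne : ∀ V ∈ Metric.sphere (0 : Coeffs m n) 1, V ≠ 0 := by
    rintro V hV rfl
    simp at hV
  have hnormal : ∀ V ∈ PPlus m n N, ‖V‖⁻¹ • V ∈ Metric.sphere (0 : Coeffs m n) 1 ∩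
      closure (PPlus m n N) := by
    intro V hV
    have hV0 := ne_zero_of_mem_PPlus hN hV
    refine ⟨?_, subset_closure (smul_mem_PPlus hV (by positivity))⟩
    rw [mem_sphere_zero_iff_norm, norm_smul, norm_inv, norm_norm,
      inv_mul_cancel₀ (norm_ne_zero_iff.2 hV0)]
  have hcont : ContinuousOn (detRatio N C a)
      (Metric.sphere (0 : Coeffs m n) 1 ∩ closure (PPlus m n N)) := by
    unfold detRatio
    refine ContinuousOn.div ?_ ?_ ?_
    · refine Continuous.continuousOn (continuous_finsetProd _ fun j hj => ?_)
      refine Continuous.rpow_const ?_ fun _ => Or.inr (ha j hj).le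
      exact Complex.continuous_re.comp (continuous_symbol _).matrix_det
    · refine ContinuousOn.rpow_const
        (Complex.continuous_re.comp (continuous_pairing C)).continuousOn fun V hV => Or.inl ?_
      exact (re_pairing_pos hC hV.2 (hne V hV.1)).ne'
    · intro V hV
      exact (Real.rpow_pos_of_pos (re_pairing_pos hC hV.2 (hne V hV.1)) _).ne'
  obtain ⟨U, hU, hmax⟩ := hK.exists_isMaxOn ⟨_, hnormal _ constOne_mem_PPlus⟩ hcont
  have hmax' : ∀ V ∈ PPlus m n N, detRatio N C a V ≤ detRatio N C a U := by
    intro V hV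
    have hV0 := ne_zero_of_mem_PPlus hN hV
    rw [← detRatio_smul hC (subset_closure hV) hV0 a (r := ‖V‖⁻¹) (by positivity)]
    exact hmax (hnormal V hV)
  refine ⟨U, ⟨isHermitian_of_mem_closure hU.2, ?_⟩, hmax'⟩
  rintro z ⟨j, hj, rfl⟩
  refine (posSemidef_of_mem_closure hU.2 (gridPoint_mem hj)).posDef_iff_det_ne_zero.2 fun hdet => ?_
  have hpos := (detRatio_pos hN hC (constOne_mem_PPlus) a).trans_le (hmax' _ constOne_mem_PPlus)
  rw [detRatio, Finset.prod_eq_zero hj, zero_div] at hpos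
  · exact lt_irrefl _ hpos
  · rw [hdet, Complex.zero_re, Real.zero_rpow (ha j hj).ne']

/-- The first-order condition at a maximiser, in a Hermitian direction. -/
lemma sum_trace_inv_mul_of_isMaxOn [NeZero m] (hN : 0 < N) {C U H : Coeffs m n}
    (hC : C ∈ CPlus m n N) (hU : U ∈ PPlus m n N) {a : ℤ → ℝ}
    (hmax : IsMaxOn (detRatio N C a) (PPlus m n N) U) (hH : (H 0).IsHermitian) :
    ∑ j ∈ gridIndex N,
        a j * ((symbol U (gridPoint N j))⁻¹ * symbol H (gridPoint N j)).trace.re =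
      (m * ∑ j ∈ gridIndex N, a j) / (pairing C U).re * (pairing C H).re := by
  have hc := re_pairing_pos hC (subset_closure hU) (ne_zero_of_mem_PPlus hN hU)
  set s : ℝ := m * ∑ j ∈ gridIndex N, a j with hs
  have hlog : ∀ V ∈ PPlus m n N, Real.log (detRatio N C a V) =
      ∑ j ∈ gridIndex N, a j * Real.log (symbol V (gridPoint N j)).det.re -
        s * Real.log (pairing C V).re := by
    intro V hV
    have hcV := re_pairing_pos hC (subset_closure hV) (ne_zero_of_mem_PPlus hN hV)
    have hdV : ∀ j ∈ gridIndex N, 0 < (symbol V (gridPoint N j)).det.re := fun j hj =>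
      (Complex.pos_iff.1 (hV.2 _ (gridPoint_mem hj)).det_pos).1
    rw [detRatio, Real.log_div
      (Finset.prod_pos fun j hj => Real.rpow_pos_of_pos (hdV j hj) _).ne'
      (Real.rpow_pos_of_pos hcV _).ne',
      Real.log_prod fun j hj => (Real.rpow_pos_of_pos (hdV j hj) _).ne', Real.log_rpow hcV]
    congr 1
    exact Finset.sum_congr rfl fun j hj => Real.log_rpow (hdV j hj) _
  have hder : HasDerivAt (fun t : ℝ =>
      ∑ j ∈ gridIndex N, a j * Real.log
        (symbol U (gridPoint N j) + t • symbol H (gridPoint N j)).det.re -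
          s * Real.log ((pairing C U).re + t * (pairing C H).re))
      (∑ j ∈ gridIndex N,
        a j * ((symbol U (gridPoint N j))⁻¹ * symbol H (gridPoint N j)).trace.re -
          s * ((pairing C H).re / (pairing C U).re)) 0 := by
    refine HasDerivAt.sub (HasDerivAt.fun_sum fun j hj =>
      (hasDerivAt_log_det_add_smul (hU.2 _ (gridPoint_mem hj)) _).const_mul _)
      (HasDerivAt.const_mul _ ?_)
    have h := (((hasDerivAt_id (0 : ℝ)).mul_const (pairing C H).re).const_add (pairing C U).re).log
      (by simpa using hc.ne')
    simpa using h
  have hext : IsLocalMax (fun t : ℝ =>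
      ∑ j ∈ gridIndex N, a j * Real.log
        (symbol U (gridPoint N j) + t • symbol H (gridPoint N j)).det.re -
          s * Real.log ((pairing C U).re + t * (pairing C H).re)) 0 := by
    filter_upwards [eventually_add_smul_mem_PPlus hU hH] with t ht
    have h1 := Real.log_le_log (detRatio_pos hN hC ht a) (hmax ht)
    rw [hlog _ ht, hlog _ hU] at h1
    simpa [symbol_add, symbol_smul, pairing_add_right, pairing_smul_right] using h1
  have h0 := hext.hasDerivAt_eq_zero hder
  rw [sub_eq_zero.1 h0]
  ring

/-! ### The moment problem -/

lemma weight_eq_re {P : Coeffs 1 n} (hP : P ∈ PPlus 1 n N) {j : ℤ} (hj : j ∈ gridIndex N) :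
    symbol P (gridPoint N j) 0 0 = ((symbol P (gridPoint N j) 0 0).re : ℂ) ∧
      0 < (symbol P (gridPoint N j) 0 0).re := by
  obtain ⟨h1, h2⟩ := Complex.pos_iff.1 ((hP.2 _ (gridPoint_mem hj)).diag_pos (i := 0))
  exact ⟨Complex.ext rfl (by simpa using h2.symm), h1⟩

lemma Phi_isHermitian {P : Coeffs 1 n} (hP : P ∈ PPlus 1 n N) {Q : Coeffs m n}
    (hQ : (Q 0).IsHermitian) {j : ℤ} (hj : j ∈ gridIndex N) :
    (Phi P Q (gridPoint N j)).IsHermitian := by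
  rw [Phi, (weight_eq_re hP hj).1, Matrix.IsHermitian, Matrix.conjTranspose_smul,
    Matrix.conjTranspose_nonsing_inv, (symbol_isHermitian hQ j).eq]
  simp

lemma re_pairing_momentCoeffs_Phi (hN : 0 < N) {P : Coeffs 1 n} (hP : P ∈ PPlus 1 n N)
    {Q H : Coeffs m n} (hQ : (Q 0).IsHermitian) (hH : (H 0).IsHermitian) :
    (pairing (momentCoeffs n N (Phi P Q)) H).re =
      ∑ j ∈ gridIndex N, ((2 * N : ℝ)⁻¹ * (symbol P (gridPoint N j) 0 0).re) *
        ((symbol Q (gridPoint N j))⁻¹ * symbol H (gridPoint N j)).trace.re := by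
  rw [pairing_momentCoeffs hN (fun j hj => Phi_isHermitian hP hQ hj) H hH, Complex.re_sum]
  refine Finset.sum_congr rfl fun j hj => ?_
  rw [Phi, Matrix.smul_mul, Matrix.trace_smul, (weight_eq_re hP hj).1, Complex.smul_re, smul_eq_mul,
    smul_eq_mul, Complex.re_ofReal_mul, Complex.ofReal_re, mul_assoc]

lemma exists_momentCoeffs_Phi_eq [NeZero m] (hN : 0 < N) {C : Coeffs m n} (hC : C ∈ CPlus m n N)
    {P : Coeffs 1 n} (hP : P ∈ PPlus 1 n N) :
    ∃ Q ∈ PPlus m n N, momentCoeffs n N (Phi P Q) = C := by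
  set a : ℤ → ℝ := fun j => (2 * N : ℝ)⁻¹ * (symbol P (gridPoint N j) 0 0).re with ha_def
  have ha : ∀ j ∈ gridIndex N, 0 < a j := fun j hj =>
    mul_pos (by positivity) (weight_eq_re hP hj).2
  obtain ⟨U, hU, hmax⟩ := exists_isMaxOn_detRatio hN hC ha
  have hc := re_pairing_pos hC (subset_closure hU) (ne_zero_of_mem_PPlus hN hU)
  have hs : 0 < m * ∑ j ∈ gridIndex N, a j := by
    refine mul_pos (by exact_mod_cast NeZero.pos m) (Finset.sum_pos ha ⟨N, by simp; omega⟩)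
  -- Rescaling to `⟨C, Q⟩ = m ∑ a_j` turns the Lagrange multiplier into `1`.
  set r : ℝ := (m * ∑ j ∈ gridIndex N, a j) / (pairing C U).re with hr_def
  have hr : 0 < r := div_pos hs hc
  have hQ := smul_mem_PPlus hU hr
  have hfirst : ∀ H : Coeffs m n, (H 0).IsHermitian →
      (pairing (momentCoeffs n N (Phi P (r • U))) H).re = (pairing C H).re := by
    intro H hH
    rw [re_pairing_momentCoeffs_Phi hN hP hQ.1 hH]
    have h1 := sum_trace_inv_mul_of_isMaxOn hN hC hU hmax hH
    have h2 : ∀ j ∈ gridIndex N, a j *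
        ((symbol (r • U) (gridPoint N j))⁻¹ * symbol H (gridPoint N j)).trace.re =
        r⁻¹ * (a j * ((symbol U (gridPoint N j))⁻¹ * symbol H (gridPoint N j)).trace.re) := by
      intro j hj
      have hinv : (r • symbol U (gridPoint N j))⁻¹ = r⁻¹ • (symbol U (gridPoint N j))⁻¹ := by
        refine Matrix.inv_eq_left_inv ?_
        rw [Matrix.smul_mul, Matrix.mul_smul, smul_smul, inv_mul_cancel₀ hr.ne', one_smul,
          Matrix.nonsing_inv_mul _ ((Matrix.isUnit_iff_isUnit_det _).1
            (hU.2 _ (gridPoint_mem hj)).isUnit)]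
      rw [symbol_smul, hinv, Matrix.smul_mul, Matrix.trace_smul, Complex.smul_re, smul_eq_mul]
      ring
    rw [Finset.sum_congr rfl h2, ← Finset.mul_sum, h1, ← mul_assoc, inv_mul_cancel₀ hr.ne',
      one_mul]
  refine ⟨r • U, hQ, sub_eq_zero.1 (eq_zero_of_re_pairing_self ?_)⟩
  have hM := momentCoeffs_zero_isHermitian (n := n) hN
    (fun j hj => Phi_isHermitian (N := N) hP hQ.1 hj)
  rw [pairing_sub_left, Complex.sub_re, hfirst _ (hM.sub hC.1), sub_self]

/-- Pairing the two equal moment sequences with `R - Q` gives a vanishing sum of the nonnegative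
terms `p_j tr ((Q⁻¹ - R⁻¹) (R - Q))(ζ_j)`, so `Q` and `R` agree on the discrete circle. -/
lemma eq_of_momentCoeffs_Phi_eq (hnN : n < N) {P : Coeffs 1 n} (hP : P ∈ PPlus 1 n N)
    {Q R : Coeffs m n} (hQ : Q ∈ PPlus m n N) (hR : R ∈ PPlus m n N)
    (h : momentCoeffs n N (Phi P Q) = momentCoeffs n N (Phi P R)) : Q = R := by
  have hN : 0 < N := by omega
  have hE : ((R - Q) 0).IsHermitian := hR.1.sub hQ.1
  have h1 := re_pairing_momentCoeffs_Phi hN hP hQ.1 hE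
  rw [h, re_pairing_momentCoeffs_Phi hN hP hR.1 hE, ← sub_eq_zero, ← neg_eq_zero, neg_sub,
    ← Finset.sum_sub_distrib] at h1
  have hterm : ∀ j ∈ gridIndex N, 0 < (2 * N : ℝ)⁻¹ * (symbol P (gridPoint N j) 0 0).re :=
    fun j hj => mul_pos (by positivity) (weight_eq_re hP hj).2
  have htr : ∀ j ∈ gridIndex N, _ := fun j hj =>
    trace_inv_sub_inv_mul_sub (hQ.2 _ (gridPoint_mem hj)) (hR.2 _ (gridPoint_mem hj))
  simp_rw [← mul_sub, ← Complex.sub_re, ← Matrix.trace_sub, ← Matrix.sub_mul, symbol_sub] at h1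
  rw [Finset.sum_eq_zero_iff_of_nonneg fun j hj =>
    mul_nonneg (hterm j hj).le (Complex.nonneg_iff.1 (htr j hj).1).1] at h1
  refine (sub_eq_zero.1 (eq_zero_of_symbol_eq_zero hnN fun j hj => ?_)).symm
  have h0 := (mul_eq_zero.1 (h1 j hj)).resolve_left (hterm j hj).ne'
  rw [symbol_sub, (htr j hj).2 (Complex.ext h0 (Complex.nonneg_iff.1 (htr j hj).1).2.symm),
    sub_self]

end CirculantExt

theorem theorem7 (m n N : ℕ) (hnN : n < N)
    (C : CirculantExt.Coeffs m n) (hC : C ∈ CirculantExt.CPlus m n N)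
    (P : CirculantExt.Coeffs 1 n) (hP : P ∈ CirculantExt.PPlus 1 n N) :
    ∃! Q : CirculantExt.Coeffs m n, Q ∈ CirculantExt.PPlus m n N ∧
      ∀ k : Fin (n + 1), CirculantExt.moment N (CirculantExt.Phi P Q) (k : ℕ) = C k := by
  have hex : ∃ Q ∈ CirculantExt.PPlus m n N,
      CirculantExt.momentCoeffs n N (CirculantExt.Phi P Q) = C := by
    rcases Nat.eq_zero_or_pos m with rfl | hm
    · exact ⟨CirculantExt.constOne 0 n, CirculantExt.constOne_mem_PPlus, Subsingleton.elim _ _⟩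
    · have : NeZero m := ⟨hm.ne'⟩
      exact CirculantExt.exists_momentCoeffs_Phi_eq (by omega) hC hP
  obtain ⟨Q, hQ, hQC⟩ := hex
  refine ⟨Q, ⟨hQ, fun k => congrFun hQC k⟩, fun R hR => ?_⟩
  refine CirculantExt.eq_of_momentCoeffs_Phi_eq hnN hP hR.1 hQ ?_
  rw [hQC]
  exact funext hR.2
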